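/- Let $X$ be a real or complex Banach space, with scalar field $\mathbb K\in\{\mathbb R,\mathbb C\}$, of (possibly infinite) dimension greater than $2$ over $\mathbb K$, and let $B(X)$ be the $\mathbb K$-algebra of bounded linear operators on $X$, with $[S,T]=ST-TS$. Then every Lie derivation of $B(X)$ is proper. That is, for every $\mathbb K$-linear map $L:B(X)\to B(X)$ (not assumed continuous) satisfying $$L([S,T])=[L(S),T]+[S,L(T)]\qquad (S,T\in B(X)),$$ there exist a $\mathbb K$-linear map $D:B(X)\to B(X)$ with $D(ST)=D(S)T+S\,D(T)$ for all $S,T\in B(X)$, and a $\mathbb K$-linear map $\tau:B(X)\to Z(B(X))$ into the center of $B(X)$ with $\tau([S,T])=0$ for all $S,T\in B(X)$, such that $L=D+\tau$. -/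

import Mathlib

/-- `D` is a derivation of the (possibly noncommutative) algebra `A`: a linear map satisfying
the Leibniz rule. -/
def IsAlgDerivation {R A : Type*} [CommRing R] [Ring A] [Algebra R A] (D : A →ₗ[R] A) : Prop :=
  ∀ a b : A, D (a * b) = D a * b + a * D b

/-- A linear map `L` on `A` is a Lie derivation: `L [a, b] = [L a, b] + [a, L b]`, where
`[a, b] = a * b - b * a`. -/
def IsLieDerivation {R A : Type*} [CommRing R] [Ring A] [Algebra R A] (L : A →ₗ[R] A) : Prop :=
  ∀ a b : A, L ⁅a, b⁆ = ⁅L a, b⁆ + ⁅a, L b⁆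

/-- `L` is of the form `D + τ`, with `D` a derivation of `A` and `τ` a linear map from `A` into
the center of `A` which vanishes on commutators. -/
def IsProperLieDerivation {R A : Type*} [CommRing R] [Ring A] [Algebra R A]
    (L : A →ₗ[R] A) : Prop :=
  ∃ (D : A →ₗ[R] A) (τ : A →ₗ[R] Subalgebra.center R A),
    IsAlgDerivation D ∧ (∀ a b : A, τ ⁅a, b⁆ = 0) ∧ ∀ a : A, L a = D a + (τ a : A)

/-- Every Lie derivation of the `R`-algebra `A` into itself is proper. -/
def HasLieDerivationProperty (R A : Type*) [CommRing R] [Ring A] [Algebra R A] : Prop :=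
  ∀ L : A →ₗ[R] A, IsLieDerivation L → IsProperLieDerivation L

/-! A rank-one idempotent `p` in `B(X)` has `p A p = K p`, and `p A` separates points of `A`. Modulo
an inner derivation, `L p` commutes with `p`, hence is scalar
(`IsLieDerivation.map_idempotent_eq_smul_one`). Subtracting from each `L a` the scalar `c (L a)`
seen in its `p`-corner gives `D`, which respects the Peirce decomposition. Faithfulness of `p A`
turns Leibniz on `p A` into Leibniz on `A`. The one obstruction is a scalar on `(1 - p) A p × p A (1
- p)`; a nonscalar in `(1 - p) A (1 - p)` kills it, and this is where dimension greater than 2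
enters. -/

section PeirceDecomposition

variable {K A : Type*} [Field K] [Ring A] [Algebra K A]

/-- The inner derivation `a ↦ t * a - a * t`. -/
def innerDerivation (K : Type*) {A : Type*} [CommRing K] [Ring A] [Algebra K A] (t : A) :
    A →ₗ[K] A :=
  LinearMap.mulLeft K t - LinearMap.mulRight K t

lemma innerDerivation_apply (t a : A) : innerDerivation K t a = t * a - a * t := rfl

lemma isAlgDerivation_innerDerivation (t : A) : IsAlgDerivation (innerDerivation K t) := by
  intro a b
  simp only [innerDerivation_apply]
  noncomm_ring

lemma IsLieDerivation.map_commutator {L : A →ₗ[K] A} (hL : IsLieDerivation L) (a b : A) :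
    L (a * b) - L (b * a) = L a * b - b * L a + (a * L b - L b * a) := by
  simpa only [Ring.lie_def, map_sub] using hL a b

lemma IsLieDerivation.sub_innerDerivation {L : A →ₗ[K] A} (hL : IsLieDerivation L) (t : A) :
    IsLieDerivation (L - innerDerivation K t) := by
  intro a b
  have h := hL a b
  simp only [LinearMap.sub_apply, h, innerDerivation_apply]
  simp only [Ring.lie_def]
  noncomm_ring

lemma IsProperLieDerivation.of_sub_innerDerivation {L : A →ₗ[K] A} (t : A)
    (h : IsProperLieDerivation (L - innerDerivation K t)) : IsProperLieDerivation L := by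
  obtain ⟨D, τ, hD, hτ, hL⟩ := h
  refine ⟨D + innerDerivation K t, τ, fun a b => ?_, hτ, fun a => ?_⟩
  · have := isAlgDerivation_innerDerivation (K := K) t a b
    simp only [LinearMap.add_apply, hD a b, this]
    noncomm_ring
  · have := hL a
    rw [LinearMap.sub_apply, sub_eq_iff_eq_add] at this
    rw [this, LinearMap.add_apply]
    abel

/-! ### Lie derivations and a minimal idempotent. -/

variable {p : A} {c : A →ₗ[K] K}

/-- If `p` is an idempotent with `p A p = K p` and `p A` is a faithful right module, then a Lie
derivation which sends `p` into the commutant of `p` sends it to a scalar. -/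
lemma IsLieDerivation.map_idempotent_eq_smul_one {L : A →ₗ[K] A} (hL : IsLieDerivation L)
    (hp : p * p = p) (hc : ∀ a, p * a * p = c a • p)
    (hfaith : ∀ b : A, (∀ a, p * a * b = 0) → b = 0) (hcomm : p * L p = L p * p) :
    L p = c (L p) • (1 : A) := by
  set b := L p with hb
  have hpb : p * b = c b • p := by
    rw [← hc b, mul_assoc, ← hcomm, ← mul_assoc, hp]
  have hbp : b * p = c b • p := by rw [← hcomm, hpb]
  -- Apply `L` to `[p, x] = x` with `x ∈ p A (1 - p)` and compress to that corner: the `L x` terms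
  -- cancel, leaving `x * b = c b • x`.
  have key : (1 - p) * (b - c b • (1 : A)) = 0 := by
    apply hfaith
    intro a
    set x := p * a * (1 - p) with hx
    have hpx : p * x = x := by rw [hx, ← mul_assoc, ← mul_assoc, hp]
    have hxp : x * p = 0 := by rw [hx, mul_assoc, sub_mul, one_mul, hp, sub_self, mul_zero]
    have h := hL.map_commutator p x
    rw [hpx, hxp, map_zero, sub_zero, ← hb] at h
    have hbx : b * x = c b • x := by
      calc b * x = b * p * x := by rw [mul_assoc, hpx]
        _ = c b • x := by rw [hbp, smul_mul_assoc, hpx]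
    have hxb : x * b * (1 - p) = x * b := by
      rw [mul_sub, mul_one, mul_assoc x b p, hbp, mul_smul_comm, hxp, smul_zero, sub_zero]
    have hpxb : p * (x * b) = x * b := by rw [← mul_assoc, hpx]
    have h2 : p * L x * (1 - p) = (c b • x - x * b) + p * L x * (1 - p) := by
      conv_lhs => rw [h, hbx]
      simp only [mul_add, add_mul, mul_sub, sub_mul, mul_one, mul_smul_comm, smul_mul_assoc, hpx,
        hxp, mul_assoc, hbp, hp, smul_zero, mul_zero, sub_zero] at hxb hpxb ⊢
      simp only [← mul_assoc, hp, hpx]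
      abel
    have h3 : c b • x - x * b = 0 := by simpa using h2
    rw [← mul_assoc, ← hx, mul_sub, mul_smul_comm, mul_one, ← neg_sub, h3, neg_zero]
  have : b - c b • (1 : A) = 0 := by
    have h4 : (1 - p) * (b - c b • (1 : A)) = b - c b • (1 : A) := by
      rw [sub_mul, one_mul, mul_sub p, hpb, mul_smul_comm, mul_one, sub_self, sub_zero]
    rw [← h4, key]
  exact sub_eq_zero.mp this

/-- A Lie derivation which sends the minimal idempotent `p` to a scalar is proper, provided that
`p A` is faithful and that the corner `(1 - p) A (1 - p)` contains a nonscalar. -/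
lemma IsLieDerivation.isProper_of_map_idempotent [CharZero K] {L : A →ₗ[K] A} (hL : IsLieDerivation L)
    (hp0 : p ≠ 0) (hp : p * p = p) (hc : ∀ a, p * a * p = c a • p)
    (hfaith : ∀ b : A, (∀ a, p * a * b = 0) → b = 0)
    (hns : ∃ z : A, p * z = 0 ∧ z * p = 0 ∧ ∀ k : K, z ≠ k • (1 - p))
    {l : K} (hLp : L p = l • (1 : A)) : IsProperLieDerivation L := by
  have hc0 : ∀ a, p * a * p = 0 → c a = 0 := fun a h => by
    rw [hc a] at h
    exact (smul_eq_zero.mp h).resolve_right hp0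
  have hc1 : c 1 = 1 := by
    have h := hc 1
    rw [mul_one, hp] at h
    have h' : (c 1 - 1) • p = 0 := by rw [sub_smul, ← h, one_smul, sub_self]
    exact sub_eq_zero.mp ((smul_eq_zero.mp h').resolve_right hp0)
  have two_zero : ∀ a : A, a = -a → a = 0 := fun a h => by
    have h' : (2 : K) • a = 0 := by rw [two_smul]; nth_rewrite 1 [h]; simp
    exact (smul_eq_zero.mp h').resolve_left two_ne_zero
  have hLcomm : ∀ a, L (p * a) - L (a * p) = p * L a - L a * p := fun a => by
    rw [hL.map_commutator, hLp]; simp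
  -- This choice makes `p * D a * p = 0` for every `a`.
  let T : A →ₗ[K] A := LinearMap.smulRight (c ∘ₗ L) (1 : A)
  let D : A →ₗ[K] A := L - T
  have hD : ∀ a, D a = L a - c (L a) • (1 : A) := fun a => rfl
  have hDp : D p = 0 := by rw [hD, hLp, map_smul, hc1]; simp
  -- the off-diagonal Peirce components are preserved
  have hx1 : ∀ x, p * x = x → x * p = 0 → p * L x = L x ∧ L x * p = 0 ∧ D x = L x := by
    intro x h1 h2
    have h := hLcomm x
    rw [h1, h2, map_zero, sub_zero] at h
    have h3 : p * L x * p = 0 := by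
      have := congrArg (fun a => p * a) h
      simp only [mul_sub, ← mul_assoc, hp] at this
      exact sub_eq_self.mp this.symm
    have h4 : L x * p = 0 := by
      apply two_zero
      have := congrArg (fun a => a * p) h
      simp only [sub_mul, mul_assoc, hp] at this
      rw [← mul_assoc, h3, zero_sub] at this
      exact this
    rw [h4, sub_zero] at h
    exact ⟨h.symm, h4, by rw [hD, hc0 _ h3]; simp⟩
  have hy1 : ∀ y, p * y = 0 → y * p = y → p * L y = 0 ∧ L y * p = L y ∧ D y = L y := by
    intro y h1 h2
    have h := hLcomm y
    rw [h1, h2, map_zero, zero_sub] at h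
    have h3 : p * L y * p = 0 := by
      have := congrArg (fun a => a * p) h
      simp only [sub_mul, mul_assoc, hp, neg_mul] at this
      rw [← mul_assoc, eq_comm, sub_eq_neg_self] at this
      exact this
    have h4 : p * L y = 0 := by
      apply two_zero
      have := congrArg (fun a => p * a) h
      simp only [mul_sub, ← mul_assoc, hp, mul_neg] at this
      rw [h3, sub_zero] at this
      exact this.symm
    rw [h4, zero_sub, neg_inj] at h
    exact ⟨h4, h.symm, by rw [hD, hc0 _ h3]; simp⟩
  have hDx : ∀ x, p * x = x → x * p = 0 → p * D x = D x ∧ D x * p = 0 := fun x h1 h2 => by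
    obtain ⟨h3, h4, h5⟩ := hx1 x h1 h2
    rw [h5]; exact ⟨h3, h4⟩
  have hDy : ∀ y, p * y = 0 → y * p = y → p * D y = 0 ∧ D y * p = D y := fun x h1 h2 => by
    obtain ⟨h3, h4, h5⟩ := hy1 x h1 h2
    rw [h5]; exact ⟨h3, h4⟩
  have hDz : ∀ z, p * z = 0 → z * p = 0 → p * D z = 0 ∧ D z * p = 0 := by
    intro z h1 h2
    have h := hLcomm z
    rw [h1, h2, sub_self, eq_comm, sub_eq_zero] at h
    have h3 : p * L z = c (L z) • p := by rw [← hc, mul_assoc, ← h, ← mul_assoc, hp]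
    rw [hD, mul_sub, sub_mul, ← h, h3]; simp
  -- commutators do not see the scalar part
  have hcommD : ∀ a b, L (a * b) - L (b * a) = D a * b - b * D a + (a * D b - D b * a) := by
    intro a b
    rw [hL.map_commutator, hD, hD]
    simp only [sub_mul, mul_sub, smul_mul_assoc, mul_smul_comm, one_mul, mul_one]
    abel
  have hxz : ∀ x z, p * x = x → x * p = 0 → p * z = 0 → z * p = 0 →
      D (x * z) = D x * z + x * D z := by
    intro x z h1 h2 h3 h4
    have h := hcommD x z
    have hzx : z * x = 0 := by rw [← h1, ← mul_assoc, h4, zero_mul]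
    have h5 : z * D x = 0 := by rw [← (hDx x h1 h2).1, ← mul_assoc, h4, zero_mul]
    have h6 : D z * x = 0 := by rw [← h1, ← mul_assoc, (hDz z h3 h4).2, zero_mul]
    rw [hzx, h5, h6, map_zero, sub_zero, sub_zero, sub_zero] at h
    rw [(hx1 (x * z) (by rw [← mul_assoc, h1]) (by rw [mul_assoc, h4, mul_zero])).2.2, h]
  -- the elements of `p A` with zero `p A p` part are faithful on `(1 - p) A`
  have hfaith' : ∀ b, p * b = 0 → (∀ x, p * x = x → x * p = 0 → x * b = 0) → b = 0 := by
    intro b hb h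
    apply hfaith
    intro a
    have := h (p * a * (1 - p)) (by rw [← mul_assoc, ← mul_assoc, hp])
      (by rw [mul_assoc, sub_mul, one_mul, hp, sub_self, mul_zero])
    rwa [mul_assoc, sub_mul, hb, one_mul, sub_zero] at this
  have hzz : ∀ z w, p * z = 0 → z * p = 0 → p * w = 0 → w * p = 0 →
      D (z * w) = D z * w + z * D w := by
    intro z w h1 h2 h3 h4
    have hpzw : p * (z * w) = 0 := by rw [← mul_assoc, h1, zero_mul]
    have hzwp : z * w * p = 0 := by rw [mul_assoc, h4, mul_zero]
    -- Expand `D (x * z * w)` in two ways and cancel `x`.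
    rw [← sub_eq_zero]
    apply hfaith'
    · rw [mul_sub, (hDz _ hpzw hzwp).1, mul_add, ← mul_assoc, ← mul_assoc, h1, (hDz z h1 h2).1]
      simp
    · intro x h5 h6
      have e1 := hxz x (z * w) h5 h6 hpzw hzwp
      have e2 := hxz (x * z) w (by rw [← mul_assoc, h5]) (by rw [mul_assoc, h2, mul_zero]) h3 h4
      rw [hxz x z h5 h6 h1 h2, mul_assoc x z w, e1] at e2
      have e3 : x * D (z * w) = x * D z * w + x * z * D w := by
        apply add_left_cancel (a := D x * (z * w))
        rw [e2]; noncomm_ring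
      rw [mul_sub, e3]; noncomm_ring
  have hcDxy : ∀ x y, p * x = x → x * p = 0 → p * y = 0 → y * p = y →
      D x * y + x * D y = c (D x * y + x * D y) • p := by
    intro x y h1 h2 h3 h4
    rw [← hc, mul_add, add_mul]
    simp only [← mul_assoc, (hDx x h1 h2).1, h1]
    simp only [mul_assoc, (hDy y h3 h4).2, h4]
  -- the defect of the Leibniz rule on `(1 - p) A p × p A (1 - p)` is scalar
  have hyx : ∀ x y, p * x = x → x * p = 0 → p * y = 0 → y * p = y →
      D (y * x) = D y * x + y * D x + c (D x * y + x * D y) • (1 - p) := by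
    intro x y h1 h2 h3 h4
    have h := hcommD x y
    have e1 : D (x * y) = 0 := by
      have : x * y = c (x * y) • p := by
        rw [← hc, mul_assoc, mul_assoc, h4, ← mul_assoc, h1]
      rw [this, map_smul, hDp, smul_zero]
    have e2 : L (x * y) = c (L (x * y)) • (1 : A) := by
      rwa [hD, sub_eq_zero] at e1
    have e3 := hD (y * x)
    have e4 := hcDxy x y h1 h2 h3 h4
    have hpyx : p * (y * x) = 0 := by rw [← mul_assoc, h3, zero_mul]
    have hyxp : y * x * p = 0 := by rw [mul_assoc, h2, mul_zero]
    have e5 := (hDz _ hpyx hyxp).1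
    set s := c (D x * y + x * D y)
    have e6 : (c (L (x * y)) - c (L (y * x)) - s) • (1 : A) + s • (1 - p)
        = D (y * x) - (D y * x + y * D x) := by
      have : L (y * x) = D (y * x) + c (L (y * x)) • (1 : A) := by rw [e3]; abel
      rw [e2, this] at h
      have h' : D (y * x) = c (L (x * y)) • (1 : A) - c (L (y * x)) • (1 : A)
          - (D x * y + x * D y) + (D y * x + y * D x) := by
        rw [← sub_eq_zero] at h ⊢
        rw [← neg_eq_zero, ← h]; abel
      rw [h', e4]
      simp only [sub_smul, smul_sub]
      abel
    -- Left multiplication by `p` kills everything in `e6` but the multiple of `1`.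
    have e7 : c (L (x * y)) - c (L (y * x)) - s = 0 := by
      have := congrArg (fun a => p * a) e6
      simp only [mul_add, mul_sub, mul_smul_comm, mul_one, hp, sub_self, smul_zero, add_zero,
        ← mul_assoc, (hDy y h3 h4).1, h3, zero_mul] at this
      simp only [e5, sub_zero] at this
      exact (smul_eq_zero.mp this).resolve_right hp0
    rw [e7, zero_smul, zero_add] at e6
    rw [e6]; abel
  -- Expanding `D (y * x * z)` in two ways gives `r • (1 - p) = s • z`, so `s = 0` as `z` is
  -- nonscalar.
  have hxy : ∀ x y, p * x = x → x * p = 0 → p * y = 0 → y * p = y → D x * y + x * D y = 0 := by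
    intro x y h1 h2 h3 h4
    obtain ⟨z, hz1, hz2, hz⟩ := hns
    have hpyx : p * (y * x) = 0 := by rw [← mul_assoc, h3, zero_mul]
    have hyxp : y * x * p = 0 := by rw [mul_assoc, h2, mul_zero]
    have e1 := hzz (y * x) z hpyx hyxp hz1 hz2
    have e2 := hyx (x * z) y (by rw [← mul_assoc, h1]) (by rw [mul_assoc, hz2, mul_zero]) h3 h4
    rw [hyx x y h1 h2 h3 h4, mul_assoc y x z, e2, hxz x z h1 h2 hz1 hz2] at e1
    rw [hcDxy x y h1 h2 h3 h4]
    set s := c (D x * y + x * D y)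
    set r := c ((D x * z + x * D z) * y + x * z * D y)
    have e3 : r • (1 - p) = s • z := by
      have : s • (1 - p) * z = s • z := by rw [smul_mul_assoc, sub_mul, hz1, one_mul, sub_zero]
      rw [add_mul _ (s • (1 - p)), this] at e1
      rw [← sub_eq_zero] at e1 ⊢
      rw [← e1]; noncomm_ring
    by_cases hs : s = 0
    · rw [hs, zero_smul]
    · refine absurd ?_ (hz (s⁻¹ * r))
      rw [mul_smul, e3, smul_smul, inv_mul_cancel₀ hs, one_smul]
  have hpD : ∀ b, D (p * b) = p * D b := by
    intro b
    have h1 : D b = D (p * b * p) + D (p * b * (1 - p)) + D ((1 - p) * b * p)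
        + D ((1 - p) * b * (1 - p)) := by
      simp only [← map_add]; congr 1; noncomm_ring
    have h2 : D (p * b) = D (p * b * p) + D (p * b * (1 - p)) := by
      rw [← map_add]; congr 1; noncomm_ring
    have hq : (1 - p) * p = 0 := by rw [sub_mul, one_mul, hp, sub_self]
    have hq' : p * (1 - p) = 0 := by rw [mul_sub, mul_one, hp, sub_self]
    have h3 : D (p * b * p) = 0 := by rw [hc, map_smul, hDp, smul_zero]
    have h4 := (hDx (p * b * (1 - p)) (by simp only [← mul_assoc, hp])
      (by rw [mul_assoc, hq, mul_zero])).1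
    have h5 := (hDy ((1 - p) * b * p) (by simp only [← mul_assoc, hq', zero_mul])
      (by rw [mul_assoc, hp])).1
    have h6 := (hDz ((1 - p) * b * (1 - p)) (by simp only [← mul_assoc, hq', zero_mul])
      (by rw [mul_assoc, hq, mul_zero])).1
    rw [h1, h2, h3, mul_add, mul_add, mul_add, h4, h5, h6]; simp
  have hxb : ∀ x b, p * x = x → x * p = 0 → D (x * b) = D x * b + x * D b := by
    intro x b h1 h2
    have hq : (1 - p) * p = 0 := by rw [sub_mul, one_mul, hp, sub_self]
    have hq' : p * (1 - p) = 0 := by rw [mul_sub, mul_one, hp, sub_self]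
    set y := (1 - p) * b * p with hy
    set z := (1 - p) * b * (1 - p) with hz
    have hb : b = p * b + (y + z) := by rw [hy, hz]; noncomm_ring
    have hy1 : p * y = 0 := by rw [hy]; simp only [← mul_assoc, hq', zero_mul]
    have hy2 : y * p = y := by rw [hy, mul_assoc, hp]
    have hz1 : p * z = 0 := by rw [hz]; simp only [← mul_assoc, hq', zero_mul]
    have hz2 : z * p = 0 := by rw [hz, mul_assoc, hq, mul_zero]
    have e1 : D (x * y) = 0 := by
      have : x * y = c (x * y) • p := by
        rw [← hc, ← mul_assoc p x y, h1, mul_assoc x y p, hy2]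
      rw [this, map_smul, hDp, smul_zero]
    have e2 := hxy x y h1 h2 hy1 hy2
    have e3 := hxz x z h1 h2 hz1 hz2
    have e4 : x * b = x * y + x * z := by
      conv_lhs => rw [hb]
      rw [mul_add, ← mul_assoc, h2, zero_mul, zero_add, mul_add]
    have e5 : D x * b = D x * y + D x * z := by
      conv_lhs => rw [hb]
      rw [mul_add, ← mul_assoc, (hDx x h1 h2).2, zero_mul, zero_add, mul_add]
    have e6 : x * D b = x * D y + x * D z := by
      conv_lhs => rw [hb]
      rw [map_add, map_add, hpD, mul_add, mul_add, ← mul_assoc, h2, zero_mul, zero_add]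
    rw [e4, e5, e6, map_add, e1, e3, zero_add]
    rw [show D x * y + D x * z + (x * D y + x * D z)
      = (D x * y + x * D y) + (D x * z + x * D z) by abel, e2, zero_add]
  have hpb : ∀ x b, p * x = x → D (x * b) = D x * b + x * D b := by
    intro x b h
    have hx : x = x * p + x * (1 - p) := by noncomm_ring
    have e1 : x * p = c x • p := by rw [← hc, h]
    have e2 := hxb (x * (1 - p)) b (by rw [← mul_assoc, h])
      (by rw [mul_assoc, sub_mul, one_mul, hp, sub_self, mul_zero])
    rw [hx, add_mul, map_add, map_add, e2, e1, smul_mul_assoc, map_smul, map_smul, hpD, hDp]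
    simp only [smul_zero, zero_add, add_mul, smul_mul_assoc]
    abel
  have hder : IsAlgDerivation D := by
    intro a b
    rw [← sub_eq_zero]
    apply hfaith
    intro e
    have h0 : p * (p * e) = p * e := by rw [← mul_assoc, hp]
    have e1 := hpb (p * e) (a * b) h0
    have e2 := hpb (p * e * a) b (by rw [← mul_assoc, h0])
    rw [hpb (p * e) a h0, mul_assoc (p * e) a b, e1] at e2
    have e3 : p * e * D (a * b) = p * e * D a * b + p * e * a * D b := by
      apply add_left_cancel (a := D (p * e) * (a * b))
      rw [e2]; noncomm_ring
    rw [mul_sub, e3]; noncomm_ring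
  have hmem : ∀ a, T a ∈ Subalgebra.toSubmodule (Subalgebra.center K A) := fun a =>
    (Subalgebra.center K A).smul_mem (Subalgebra.center K A).one_mem _
  refine ⟨D, T.codRestrict (Subalgebra.toSubmodule (Subalgebra.center K A)) hmem, hder,
    fun a b => Subtype.ext ?_, fun a => ?_⟩
  -- `L` and the derivation `D` agree on commutators, and `T = L - D`.
  · change T ⁅a, b⁆ = 0
    have h1 : T ⁅a, b⁆ = L ⁅a, b⁆ - D ⁅a, b⁆ := (sub_sub_cancel _ _).symm
    rw [h1, Ring.lie_def, map_sub, map_sub, hcommD, hder, hder]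
    abel
  · exact (sub_add_cancel (L a) (T a)).symm

/-- An algebra with a minimal idempotent `p` such that `p A` is faithful and `(1 - p) A (1 - p)`
contains a nonscalar has only proper Lie derivations. -/
theorem hasLieDerivationProperty_of_minimal_idempotent [CharZero K]
    (hp0 : p ≠ 0) (hp : p * p = p) (hc : ∀ a, p * a * p = c a • p)
    (hfaith : ∀ b : A, (∀ a, p * a * b = 0) → b = 0)
    (hns : ∃ z : A, p * z = 0 ∧ z * p = 0 ∧ ∀ k : K, z ≠ k • (1 - p)) :
    HasLieDerivationProperty K A := by
  intro L hL
  -- `[t, p]` is the off-diagonal Peirce part of `L p`.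
  set t := L p * p - p * L p with ht
  apply IsProperLieDerivation.of_sub_innerDerivation t
  have hL' := hL.sub_innerDerivation t
  refine hL'.isProper_of_map_idempotent hp0 hp hc hfaith hns
    (hL'.map_idempotent_eq_smul_one hp hc hfaith ?_)
  simp only [LinearMap.sub_apply, innerDerivation_apply, ht, mul_sub, sub_mul, ← mul_assoc, hp]
  simp only [mul_assoc, hp]
  abel

end PeirceDecomposition

/-! ### Rank-one operators on a Banach space. -/

theorem corollary4p4 {𝕜 : Type*} [RCLike 𝕜] {X : Type*} [NormedAddCommGroup X]
    [NormedSpace 𝕜 X] [CompleteSpace X] (hX : 2 < Module.rank 𝕜 X) :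
    HasLieDerivationProperty 𝕜 (X →L[𝕜] X) := by
  have h3 : ((3 : ℕ) : Cardinal) ≤ Module.rank 𝕜 X := by
    have h := Order.succ_le_of_lt hX
    rw [show (2 : Cardinal) = ((2 : ℕ) : Cardinal) by norm_num, Cardinal.succ_natCast] at h
    exact_mod_cast h
  obtain ⟨v, hv⟩ : ∃ v : Fin 3 → X, LinearIndependent 𝕜 v := by
    obtain ⟨s, hs, hli⟩ := le_rank_iff_exists_linearIndependent_finset.mp h3
    exact ⟨_, hli.comp _ (s.equivFinOfCardEq hs).symm.injective⟩
  have hsep : ∀ x : X, x ≠ 0 → ∃ f : X →L[𝕜] 𝕜, f x = 1 := fun x hx =>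
    SeparatingDual.exists_eq_one hx
  obtain ⟨f, hf⟩ := hsep (v 0) (hv.ne_zero 0)
  have hindep : ∀ k : 𝕜, v 2 - f (v 2) • v 0 ≠ k • (v 1 - f (v 1) • v 0) := by
    intro k h
    have h0 : (k * f (v 1) - f (v 2)) • v 0 + (-k) • v 1 + (1 : 𝕜) • v 2 = 0 := by
      rw [← sub_eq_zero] at h
      rw [← h]
      module
    have := Fintype.linearIndependent_iff.mp hv ![k * f (v 1) - f (v 2), -k, 1]
      (by simpa [Fin.sum_univ_three] using h0) 2
    simp at this
  have hu : v 1 - f (v 1) • v 0 ≠ 0 := by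
    intro h
    have h0 : (-f (v 1)) • v 0 + (1 : 𝕜) • v 1 + (0 : 𝕜) • v 2 = 0 := by
      rw [← h]
      module
    have := Fintype.linearIndependent_iff.mp hv ![-f (v 1), 1, 0]
      (by simpa [Fin.sum_univ_three] using h0) 1
    simp at this
  obtain ⟨g, hg⟩ := hsep _ hu
  set e := v 0
  set u := v 1 - f (v 1) • e with hu_def
  set w := v 2 - f (v 2) • e with hw_def
  have he : e ≠ 0 := hv.ne_zero 0
  have hfu : f u = 0 := by simp [hu_def, hf]
  have hfw : f w = 0 := by simp [hw_def, hf]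
  let p : X →L[𝕜] X := f.smulRight e
  have hpx : ∀ x, p x = f x • e := fun x => rfl
  let c : (X →L[𝕜] X) →ₗ[𝕜] 𝕜 :=
    { toFun := fun a => f (a e)
      map_add' := fun a b => by simp
      map_smul' := fun k a => by simp }
  have hca : ∀ a, c a = f (a e) := fun a => rfl
  refine hasLieDerivationProperty_of_minimal_idempotent (p := p) (c := c) ?_ ?_ ?_ ?_ ?_
  · intro h
    apply he
    simpa [hpx, hf] using congrArg (fun a : X →L[𝕜] X => a e) h
  · ext x
    simp [hpx, hf]
  · intro a
    ext x
    simp [hpx, hca, smul_smul, mul_comm]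
  · intro b hb
    ext x
    by_contra hbx
    obtain ⟨h, hh⟩ := hsep (b x) hbx
    apply he
    simpa [hpx, hf, hh] using congrArg (fun a : X →L[𝕜] X => a x) (hb (h.smulRight e))
  -- The functional kills `e` and `f w = 0`, so both products with `p` vanish. The operator sends
  -- `u` to `w`, whereas `k • (1 - p)` sends it to `k • u`.
  · refine ⟨(g - g e • f).smulRight w, ?_, ?_, fun k h => hindep k ?_⟩
    · ext x
      simp [hpx, hfw]
    · ext x
      simp [hpx, hf]
    · simpa [hpx, hfu, hg] using congrArg (fun a : X →L[𝕜] X => a u) h
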